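/- A matrix $A\in\mathbb{R}^{n\times N}$ satisfies the restricted isometry property (RIP) of order $s$ with constant $\delta$ if $(1-\delta)\|z\|_2^2\le\|A_Tz\|_2^2\le(1+\delta)\|z\|_2^2$ for all $T\subset\{1,\dots,N\}$ with $|T|\le s$ and all $z\in\mathbb{R}^{|T|}$, where $A_T$ consists of the columns of $A$ indexed by $T$. For every $\delta\in(0,1)$ there exist constants $c_1,c_2>0$ depending only on $\delta$ such that the following holds. Let $m,d,e\ge 1$ and $1\le l\le k$ be integers, put $n=ld$ and $N=ke$, and suppose $3m\le N$. Let $$\Phi=\begin{pmatrix}\Phi_k&\Phi_{k-1}&\cdots&\Phi_2&\Phi_1\\ \Phi_1&\Phi_k&\cdots&\Phi_3&\Phi_2\\ \vdots&\vdots&&\vdots&\vdots\\ \Phi_{l-1}&\Phi_{l-2}&\cdots&\cdots&\Phi_l\end{pmatrix}\in\mathbb{R}^{n\times N}$$ be the matrix of the first $l$ block rows of the circulant block matrix with blocks $\Phi_1,\dots,\Phi_k\in\mathbb{R}^{d\times e}$ (block indices are taken modulo $k$), where all $kde$ entries of the blocks $\Phi_1,\dots,\Phi_k$ are independent and identically distributed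 with one of the following three laws: the normal law $N(0,1/n)$; the law giving probability $1/2$ to each of $\pm1/\sqrt n$; the law giving probability $1/6$ to each of $\pm\sqrt{3/n}$ and probability $2/3$ to $0$. Then: (i) If $l\le 3m(3m-1)$ and $n\ge c_1\,l\,m\ln(N/m)$, then $\Phi$ satisfies RIP of order $3m$ with constant $\delta$ with probability at least $1-e^{-c_2n/l}$. (ii) If $l>3m(3m-1)$ and $n\ge c_1\,m^3\ln(N/m)$, then $\Phi$ satisfies RIP of order $3m$ with constant $\delta$ with probability at least $1-e^{-c_2n/m^2}$. -/

import Mathlib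

open MeasureTheory ProbabilityTheory

/-- The restricted isometry property of order `s` with constant `δ`: every submatrix `A_T` formed
by a set `T` of at most `s` columns is a `δ`-near-isometry for the Euclidean norms. -/
def SatisfiesRIP {ι κ : Type*} [Fintype ι] (A : Matrix ι κ ℝ) (s : ℕ) (δ : ℝ) : Prop :=
  ∀ T : Finset κ, T.card ≤ s → ∀ z : EuclideanSpace ℝ T,
    (1 - δ) * ‖z‖ ^ 2
        ≤ ‖WithLp.toLp 2 ((A.submatrix id (fun t : T => (t : κ))).mulVec z.ofLp)‖ ^ 2 ∧
      ‖WithLp.toLp 2 ((A.submatrix id (fun t : T => (t : κ))).mulVec z.ofLp)‖ ^ 2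
        ≤ (1 + δ) * ‖z‖ ^ 2

/-- The symmetric law on `{1/√n, -1/√n}`. -/
noncomputable def signLaw (n : ℕ) : Measure ℝ :=
  ENNReal.ofReal (1 / 2) • Measure.dirac (1 / √(n : ℝ)) +
    ENNReal.ofReal (1 / 2) • Measure.dirac (-(1 / √(n : ℝ)))

/-- The symmetric law on `{√(3/n), 0, -√(3/n)}` with weights `1/6, 2/3, 1/6`. -/
noncomputable def sparseSignLaw (n : ℕ) : Measure ℝ :=
  ENNReal.ofReal (1 / 6) • Measure.dirac √(3 / (n : ℝ)) +
    ENNReal.ofReal (2 / 3) • Measure.dirac (0 : ℝ) +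
    ENNReal.ofReal (1 / 6) • Measure.dirac (-√(3 / (n : ℝ)))

/-- The three admissible entry laws for a matrix with `n` rows: `N(0, 1/n)`, the sign law and the
sparse sign law. -/
def IsEntryLaw (n : ℕ) (ν : Measure ℝ) : Prop :=
  ν = gaussianReal 0 (1 / (n : NNReal)) ∨ ν = signLaw n ∨ ν = sparseSignLaw n

/-- The block matrix with `l` block rows and `k` block columns whose block in position `(r, c)`
(both counted from `0`) is `B (r - c)`, indices being taken modulo `k`. As `B_0 = B_k`, the first
block row is `B_k, B_{k-1}, …, B_1`, the second one is `B_1, B_k, …, B_2`, and so on: for `l ≤ k`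
these are the first `l` block rows of a circulant block matrix. -/
def circulantBlock {d e : ℕ} (l k : ℕ) (B : ZMod k → Matrix (Fin d) (Fin e) ℝ) :
    Matrix (Fin l × Fin d) (Fin k × Fin e) ℝ :=
  Matrix.of fun p q =>
    B (((p.1 : ℕ) : ZMod k) - ((q.1 : ℕ) : ZMod k)) p.2 q.2

open scoped NNReal ENNReal

/-!
For a fixed vector `z` supported on a set `T` of columns, `‖Φ_T z‖² - ‖z‖²` is, up to scaling, a sum
over the rows of centred squares of unit-variance sub-Gaussian variables, hence of sub-exponential
variables. Rows that share an entry of the blocks are dependent, so the graph of these conflicts is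
coloured: rows of one colour are independent, and the convexity of `exp` combines the colour classes
at the price of dividing the exponent `n` by the number of colours. The position of a row within its
block row gives a colouring with `l` colours; a greedy colouring gives one with `9 m²` colours, as a
row conflicts with at most `3m (3m - 1)` others. The estimate extends from fixed vectors to all of
them by a `1/4`-net of the unit ball and a union bound over the supports `T`.
-/

section Subexponential

variable {Ω : Type*} [MeasurableSpace Ω] {μ : Measure Ω} {Y : Ω → ℝ} {v v' b b' : ℝ}

/-- The sub-exponential analogue of `HasSubgaussianMGF`: the moment generating function of `Y` is at
most that of a centred Gaussian variable of variance `v`, for `|t|` up to `1 / b` only. The range is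
written without a division so that `b = 0` puts no restriction on `t`. -/
structure HasSubexponentialMGF (Y : Ω → ℝ) (v b : ℝ) (μ : Measure Ω) : Prop where
  integrable_exp_mul : ∀ t, |t| * b ≤ 1 → Integrable (fun ω => Real.exp (t * Y ω)) μ
  mgf_le : ∀ t, |t| * b ≤ 1 → mgf Y μ t ≤ Real.exp (v * t ^ 2 / 2)

lemma exists_convex_weights {C : Type*} [Fintype C] [Nonempty C] {a : C → ℝ}
    (ha : ∀ c, 0 ≤ a c) (ha_sum : 0 < ∑ c, a c) :
    ∃ q : C → ℝ, (∀ c, 0 < q c) ∧ ∑ c, q c = 1 ∧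
      (∀ c, a c ≤ q c ^ 2 * ((∑ c, a c) * Fintype.card C)) ∧
      ∀ c, 1 ≤ 2 * Fintype.card C * q c := by
  set n := ∑ c, a c with n_def
  set χ : ℝ := (Fintype.card C : ℝ) with χ_def
  have χ_pos : 0 < χ := Nat.cast_pos.2 Fintype.card_pos
  have ratio_nonneg (c : C) : 0 ≤ a c / n := div_nonneg (ha c) ha_sum.le
  -- The weights `a c / n` control `a c`, the uniform weights `1 / χ` keep `q c` away from `0`.
  refine ⟨fun c => (a c / n + 1 / χ) / 2, fun c => ?_, ?_, fun c => ?_, fun c => ?_⟩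
  · have := ratio_nonneg c
    positivity
  · rw [← Finset.sum_div, Finset.sum_add_distrib, ← Finset.sum_div, ← n_def, Finset.sum_const,
      Finset.card_univ, nsmul_eq_mul, ← χ_def, mul_one_div_cancel χ_pos.ne', div_self ha_sum.ne']
    norm_num
  · calc a c = a c / n * (1 / χ) * (n * χ) := by field_simp
      _ ≤ ((a c / n + 1 / χ) / 2) ^ 2 * (n * χ) := by
        gcongr
        nlinarith [sq_nonneg (a c / n - 1 / χ)]
  · calc 1 = 2 * χ * ((0 + 1 / χ) / 2) := by field_simp; ring
      _ ≤ 2 * χ * ((a c / n + 1 / χ) / 2) := by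
        gcongr
        exact ratio_nonneg c

lemma exp_le_one_add_add_sq_mul_exp_abs (y : ℝ) :
    Real.exp y ≤ 1 + y + y ^ 2 * Real.exp |y| := by
  have taylor := Complex.norm_exp_sub_sum_le_norm_mul_exp (y : ℂ) 2
  have remainder_eq : Complex.exp y - ∑ m ∈ Finset.range 2, (y : ℂ) ^ m / m.factorial
      = ((Real.exp y - (1 + y) : ℝ) : ℂ) := by
    simp [Finset.sum_range_succ]
  rw [remainder_eq, Complex.norm_real, Complex.norm_real, Real.norm_eq_abs, Real.norm_eq_abs,
    sq_abs] at taylor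
  linarith [le_abs_self (Real.exp y - (1 + y))]

lemma exp_mul_le_of_abs_le_half {r t y : ℝ} (hr : 0 < r) (ht : |t| ≤ r / 2) :
    Real.exp (t * y) ≤ 1 + t * y + 8 * t ^ 2 / r ^ 2 * Real.exp (r * |y|) := by
  have exp_le : Real.exp |t * y| ≤ Real.exp (r * |y| / 2) := by
    rw [abs_mul]
    gcongr
    nlinarith [abs_nonneg y]
  have sq_le : y ^ 2 ≤ 8 / r ^ 2 * Real.exp (r * |y| / 2) := by
    have := Real.quadratic_le_exp_of_nonneg (x := r * |y| / 2) (by positivity)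
    rw [div_mul_eq_mul_div, le_div_iff₀ (by positivity), ← sq_abs y]
    nlinarith [mul_nonneg hr.le (abs_nonneg y)]
  calc Real.exp (t * y)
      ≤ 1 + t * y + (t * y) ^ 2 * Real.exp |t * y| := exp_le_one_add_add_sq_mul_exp_abs _
    _ ≤ 1 + t * y + t ^ 2 * (8 / r ^ 2 * Real.exp (r * |y| / 2)) * Real.exp (r * |y| / 2) := by
        rw [mul_pow]
        gcongr
    _ = 1 + t * y + 8 * t ^ 2 / r ^ 2 * Real.exp (r * |y|) := by
        rw [← add_halves (r * |y|), Real.exp_add, add_halves]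
        ring

lemma integrable_exp_mul_of_integrable_exp_mul_abs {r t : ℝ} (hY : AEMeasurable Y μ)
    (hint : Integrable (fun ω => Real.exp (r * |Y ω|)) μ) (ht : |t| ≤ r) :
    Integrable (fun ω => Real.exp (t * Y ω)) μ := by
  refine hint.mono' (by fun_prop) (ae_of_all _ fun ω => ?_)
  rw [Real.norm_of_nonneg (Real.exp_pos _).le, Real.exp_le_exp]
  calc t * Y ω ≤ |t| * |Y ω| := (le_abs_self _).trans (abs_mul _ _).le
    _ ≤ r * |Y ω| := by gcongr

namespace HasSubexponentialMGF

lemma mono (h : HasSubexponentialMGF Y v b μ) (hv : v ≤ v') (hb : b ≤ b') :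
    HasSubexponentialMGF Y v' b' μ where
  integrable_exp_mul t ht :=
    h.integrable_exp_mul t ((mul_le_mul_of_nonneg_left hb (abs_nonneg t)).trans ht)
  mgf_le t ht := (h.mgf_le t ((mul_le_mul_of_nonneg_left hb (abs_nonneg t)).trans ht)).trans
    (by gcongr)

lemma of_integral_exp_mul_abs_le [IsProbabilityMeasure μ] {r M : ℝ} (hr : 0 < r)
    (hY : AEMeasurable Y μ) (hY0 : ∫ ω, Y ω ∂μ = 0)
    (hint : Integrable (fun ω => Real.exp (r * |Y ω|)) μ)
    (hM : ∫ ω, Real.exp (r * |Y ω|) ∂μ ≤ M) :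
    HasSubexponentialMGF Y (16 * M / r ^ 2) (2 / r) μ := by
  have abs_le_half {t : ℝ} (ht : |t| * (2 / r) ≤ 1) : |t| ≤ r / 2 := by
    rw [← mul_div_assoc, div_le_one hr] at ht
    linarith
  have integrable_Y : Integrable Y μ := by
    refine ((hint.const_mul r⁻¹)).mono' hY.aestronglyMeasurable (ae_of_all _ fun ω => ?_)
    rw [Real.norm_eq_abs, inv_mul_eq_div, le_div_iff₀' hr]
    linarith [Real.add_one_le_exp (r * |Y ω|)]
  refine ⟨fun t ht => integrable_exp_mul_of_integrable_exp_mul_abs hY hint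
    ((abs_le_half ht).trans (by linarith)), fun t ht => ?_⟩
  calc mgf Y μ t
      ≤ ∫ ω, (1 + t * Y ω + 8 * t ^ 2 / r ^ 2 * Real.exp (r * |Y ω|)) ∂μ :=
        integral_mono_of_nonneg (ae_of_all _ fun ω => (Real.exp_pos _).le)
          (((integrable_const 1).add (integrable_Y.const_mul t)).add (hint.const_mul _))
          (ae_of_all _ fun ω => exp_mul_le_of_abs_le_half hr (abs_le_half ht))
    _ = 1 + 8 * t ^ 2 / r ^ 2 * ∫ ω, Real.exp (r * |Y ω|) ∂μ := by
        rw [integral_add (by fun_prop) (by fun_prop), integral_add (by fun_prop) (by fun_prop),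
          integral_const_mul, integral_const_mul, hY0]
        simp
    _ ≤ 8 * t ^ 2 / r ^ 2 * M + 1 := by
        rw [add_comm]
        gcongr
    _ ≤ Real.exp (16 * M / r ^ 2 * t ^ 2 / 2) := by
        convert! Real.add_one_le_exp (8 * t ^ 2 / r ^ 2 * M) using 2
        ring

lemma aemeasurable (h : HasSubexponentialMGF Y v b μ) : AEMeasurable Y μ := by
  have ht : |(|b| + 1)⁻¹| * b ≤ 1 := by
    rw [abs_of_pos (by positivity), inv_mul_le_one₀ (by positivity)]
    linarith [le_abs_self b]
  have := Real.aemeasurable_of_aemeasurable_exp (h.integrable_exp_mul _ ht).aemeasurable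
  simpa [mul_inv_cancel_left₀ (show |b| + 1 ≠ 0 by positivity)] using this.const_mul (|b| + 1)

lemma sum_of_iIndepFun {ι : Type*} [Fintype ι] {Y : ι → Ω → ℝ} (hindep : iIndepFun Y μ)
    {v : ι → ℝ} (h : ∀ i, HasSubexponentialMGF (Y i) (v i) b μ) :
    HasSubexponentialMGF (fun ω => ∑ i, Y i ω) (∑ i, v i) b μ := by
  have := hindep.isProbabilityMeasure
  have mgf_sum (t : ℝ) : mgf (fun ω => ∑ i, Y i ω) μ t = ∏ i, mgf (Y i) μ t := by
    simpa only [Finset.sum_fn] using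
      hindep.mgf_sum₀ (t := t) (fun i => (h i).aemeasurable) Finset.univ
  refine ⟨fun t ht => ?_, fun t ht => ?_⟩
  · rw [← mgf_pos_iff, mgf_sum]
    exact Finset.prod_pos fun i _ => mgf_pos ((h i).integrable_exp_mul t ht)
  · rw [mgf_sum, Finset.sum_mul, Finset.sum_div, Real.exp_sum]
    exact Finset.prod_le_prod (fun i _ => mgf_nonneg) fun i _ => (h i).mgf_le t ht

lemma sum_of_convex_weights {ι : Type*} [Fintype ι] {Y : ι → Ω → ℝ} {q : ι → ℝ}
    (hq : ∀ i, 0 < q i) (hq1 : ∑ i, q i = 1)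
    (h : ∀ i, HasSubexponentialMGF (Y i) (q i ^ 2 * v) (q i * b) μ) :
    HasSubexponentialMGF (fun ω => ∑ i, Y i ω) v b μ := by
  have in_range {t : ℝ} (ht : |t| * b ≤ 1) (i : ι) : |t / q i| * (q i * b) ≤ 1 := by
    rwa [abs_div, abs_of_pos (hq i), ← mul_assoc, div_mul_cancel₀ _ (hq i).ne']
  have jensen (t : ℝ) (ω : Ω) :
      Real.exp (t * ∑ i, Y i ω) ≤ ∑ i, q i * Real.exp (t / q i * Y i ω) := by
    have := convexOn_exp.map_sum_le (t := Finset.univ) (p := fun i => t / q i * Y i ω)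
      (fun i _ => (hq i).le) hq1 fun i _ => Set.mem_univ _
    simp only [smul_eq_mul] at this
    convert! this using 2
    rw [Finset.mul_sum]
    exact Finset.sum_congr rfl fun i _ => by field_simp [(hq i).ne']
  have integrable_sum {t : ℝ} (ht : |t| * b ≤ 1) :
      Integrable (fun ω => ∑ i, q i * Real.exp (t / q i * Y i ω)) μ :=
    integrable_finsetSum _ fun i _ =>
      ((h i).integrable_exp_mul _ (in_range ht i)).const_mul _
  refine ⟨fun t ht => ?_, fun t ht => ?_⟩
  · have (i : ι) : AEMeasurable (Y i) μ := (h i).aemeasurable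
    refine (integrable_sum ht).mono' (by fun_prop) (ae_of_all _ fun ω => ?_)
    rw [Real.norm_of_nonneg (Real.exp_pos _).le]
    exact jensen t ω
  · calc mgf (fun ω => ∑ i, Y i ω) μ t
        ≤ ∫ ω, ∑ i, q i * Real.exp (t / q i * Y i ω) ∂μ :=
          integral_mono_of_nonneg (ae_of_all _ fun ω => (Real.exp_pos _).le) (integrable_sum ht)
            (ae_of_all _ (jensen t))
      _ = ∑ i, q i * mgf (Y i) μ (t / q i) := by
          rw [integral_finsetSum _ fun i _ =>
            ((h i).integrable_exp_mul _ (in_range ht i)).const_mul _]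
          simp only [integral_const_mul, mgf]
      _ ≤ ∑ i, q i * Real.exp (v * t ^ 2 / 2) := by
          gcongr with i
          · exact (hq i).le
          · refine ((h i).mgf_le _ (in_range ht i)).trans_eq ?_
            congr 1
            field_simp [(hq i).ne']
      _ = Real.exp (v * t ^ 2 / 2) := by rw [← Finset.sum_mul, hq1, one_mul]

lemma sum_of_coloring {ι C : Type*} [Fintype ι] [Nonempty ι] [Fintype C]
    {Y : ι → Ω → ℝ} (f : ι → C) (hv : 0 ≤ v) (hb : 0 ≤ b)
    (hindep : ∀ c, iIndepFun (fun i : {i // f i = c} => Y i) μ)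
    (h : ∀ i, HasSubexponentialMGF (Y i) v b μ) :
    HasSubexponentialMGF (fun ω => ∑ i, Y i ω)
      (Fintype.card ι * Fintype.card C * v) (2 * Fintype.card C * b) μ := by
  classical
  have : Nonempty C := Nonempty.map f ‹_›
  have sum_card_fiber : ∑ c, (Fintype.card {i // f i = c} : ℝ) = Fintype.card ι := by
    rw [← Nat.cast_sum, ← Fintype.card_sigma, Fintype.card_congr (Equiv.sigmaFiberEquiv f)]
  obtain ⟨q, q_pos, sum_q, card_le, one_le⟩ := exists_convex_weights
    (a := fun c => (Fintype.card {i // f i = c} : ℝ)) (fun c => by positivity)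
    (by rw [sum_card_fiber]; exact_mod_cast Fintype.card_pos)
  rw [sum_card_fiber] at card_le
  simp_rw [← Fintype.sum_fiberwise f fun i => Y i _]
  refine sum_of_convex_weights q_pos sum_q fun c =>
    (sum_of_iIndepFun (hindep c) fun i => h i).mono ?_ ?_
  · rw [Finset.sum_const, Finset.card_univ, nsmul_eq_mul, ← mul_assoc]
    exact mul_le_mul_of_nonneg_right (card_le c) hv
  · rw [← mul_assoc, ← mul_assoc]
    exact le_mul_of_one_le_left hb (by linarith [one_le c])

lemma measureReal_le_abs_le [IsFiniteMeasure μ] {ε : ℝ} (h : HasSubexponentialMGF Y v b μ)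
    (hε : 0 ≤ ε) (hv : 0 < v) (hεb : ε * b ≤ v) :
    μ.real {ω | ε ≤ |Y ω|} ≤ 2 * Real.exp (-ε ^ 2 / (2 * v)) := by
  have in_range : |ε / v| * b ≤ 1 := by
    rwa [abs_of_nonneg (by positivity), div_mul_eq_mul_div, div_le_one hv]
  have exponent : -(ε / v) * ε + v * (ε / v) ^ 2 / 2 = -ε ^ 2 / (2 * v) := by
    field_simp
    ring
  have upper : μ.real {ω | ε ≤ Y ω} ≤ Real.exp (-ε ^ 2 / (2 * v)) := by
    refine (measure_ge_le_exp_mul_mgf ε (by positivity)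
      (h.integrable_exp_mul _ in_range)).trans ?_
    rw [← exponent, Real.exp_add]
    gcongr
    exact h.mgf_le _ in_range
  have lower : μ.real {ω | Y ω ≤ -ε} ≤ Real.exp (-ε ^ 2 / (2 * v)) := by
    rw [← abs_neg] at in_range
    refine (measure_le_le_exp_mul_mgf (-ε) (neg_nonpos.2 (by positivity))
      (h.integrable_exp_mul _ in_range)).trans ?_
    rw [← exponent, Real.exp_add, ← neg_sq (ε / v), neg_mul_neg, neg_mul_comm]
    gcongr
    exact h.mgf_le _ in_range
  calc μ.real {ω | ε ≤ |Y ω|}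
      ≤ μ.real ({ω | ε ≤ Y ω} ∪ {ω | Y ω ≤ -ε}) :=
        measureReal_mono fun ω (hω : ε ≤ |Y ω|) => (le_abs.1 hω).imp id le_neg.2
    _ ≤ 2 * Real.exp (-ε ^ 2 / (2 * v)) := by
        linarith [measureReal_union_le (μ := μ) {ω | ε ≤ Y ω} {ω | Y ω ≤ -ε}]

end HasSubexponentialMGF

end Subexponential

section SubgaussianSquare

variable {Ω : Type*} [MeasurableSpace Ω] {μ : Measure Ω} {X : Ω → ℝ} {K v : ℝ≥0}

lemma lintegral_exp_mul_sq_gaussianReal (hv : v ≠ 0) {c : ℝ} (hc : c * v < 1) :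
    ∫⁻ t, ENNReal.ofReal (Real.exp (c * t ^ 2 / 2)) ∂(gaussianReal 0 v)
      = ENNReal.ofReal (√(1 - c * v))⁻¹ := by
  have : (0 : ℝ) < v := by positivity
  have rate_pos : 0 < (1 - c * v) / (2 * v) := div_pos (by linarith) (by positivity)
  have density_mul (t : ℝ) :
      (gaussianPDF 0 v * fun t ↦ ENNReal.ofReal (Real.exp (c * t ^ 2 / 2))) t
        = ENNReal.ofReal ((√(2 * Real.pi * v))⁻¹ *
            Real.exp (-((1 - c * v) / (2 * v)) * t ^ 2)) := by
    rw [Pi.mul_apply, gaussianPDF, gaussianPDFReal, ← ENNReal.ofReal_mul (by positivity), mul_assoc,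
      ← Real.exp_add]
    congr 3
    field_simp
    ring
  rw [gaussianReal_of_var_ne_zero _ hv, lintegral_withDensity_eq_lintegral_mul _
    (measurable_gaussianPDF _ _) (by fun_prop)]
  simp_rw [density_mul]
  rw [← ofReal_integral_eq_lintegral_ofReal ((integrable_exp_neg_mul_sq rate_pos).const_mul _)
    (ae_of_all _ fun t => by positivity), integral_const_mul, integral_gaussian, ← Real.sqrt_inv,
    ← Real.sqrt_inv, ← Real.sqrt_mul (by positivity)]
  congr 2
  field_simp

lemma lintegral_exp_mul_gaussianReal (x : ℝ) :
    ∫⁻ t, ENNReal.ofReal (Real.exp (t * x)) ∂(gaussianReal 0 v)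
      = ENNReal.ofReal (Real.exp (v * x ^ 2 / 2)) := by
  have mgf_eq := congrFun (mgf_fun_id_gaussianReal (μ := 0) (v := v)) x
  simp only [mgf, zero_mul, zero_add] at mgf_eq
  simp_rw [mul_comm _ x]
  rw [← mgf_eq, ← ofReal_integral_eq_lintegral_ofReal (integrable_exp_mul_gaussianReal x)
    (ae_of_all _ fun t => by positivity)]

-- Writing `exp (v X² / 2)` as a Gaussian average of `exp (t X)` and exchanging the two integrals
-- reduces the bound to the Gaussian case.
lemma lintegral_exp_mul_sq_le [SFinite μ] (hX : HasSubgaussianMGF X K μ) (hv : v ≠ 0)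
    (hKv : (K : ℝ) * v < 1) :
    ∫⁻ ω, ENNReal.ofReal (Real.exp (v * X ω ^ 2 / 2)) ∂μ ≤ ENNReal.ofReal (√(1 - K * v))⁻¹ := by
  have := hX.aemeasurable
  simp_rw [← lintegral_exp_mul_gaussianReal]
  rw [lintegral_lintegral_swap (by fun_prop), ← lintegral_exp_mul_sq_gaussianReal hv hKv]
  refine lintegral_mono fun t => ?_
  rw [← ofReal_integral_eq_lintegral_ofReal (hX.integrable_exp_mul t)
    (ae_of_all _ fun t => by positivity)]
  exact ENNReal.ofReal_le_ofReal (hX.mgf_le t)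

lemma integrable_exp_mul_sq [SFinite μ] (hX : HasSubgaussianMGF X K μ) (hv : v ≠ 0)
    (hKv : (K : ℝ) * v < 1) : Integrable (fun ω => Real.exp (v * X ω ^ 2 / 2)) μ := by
  have := hX.aemeasurable
  refine ⟨(by fun_prop : AEMeasurable _ μ).aestronglyMeasurable, ?_⟩
  rw [hasFiniteIntegral_iff_ofReal (ae_of_all _ fun t => by positivity)]
  exact (lintegral_exp_mul_sq_le hX hv hKv).trans_lt ENNReal.ofReal_lt_top

lemma integral_exp_mul_sq_le [SFinite μ] (hX : HasSubgaussianMGF X K μ) (hv : v ≠ 0)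
    (hKv : (K : ℝ) * v < 1) :
    ∫ ω, Real.exp (v * X ω ^ 2 / 2) ∂μ ≤ (√(1 - K * v))⁻¹ := by
  have := lintegral_exp_mul_sq_le hX hv hKv
  rwa [← ofReal_integral_eq_lintegral_ofReal (integrable_exp_mul_sq hX hv hKv)
    (ae_of_all _ fun t => by positivity), ENNReal.ofReal_le_ofReal_iff (by positivity)] at this

lemma integral_eq_zero_of_hasSubgaussianMGF [IsProbabilityMeasure μ]
    (hX : HasSubgaussianMGF X K μ) : ∫ ω, X ω ∂μ = 0 := by
  set m := ∫ ω, X ω ∂μ with m_def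
  have jensen (t : ℝ) : t * m ≤ K * t ^ 2 / 2 := by
    rw [← Real.exp_le_exp]
    refine le_trans ?_ (hX.mgf_le t)
    rw [m_def, ← integral_const_mul]
    exact convexOn_exp.map_integral_le Real.continuous_exp.continuousOn isClosed_univ (by simp)
      (hX.integrable.const_mul t) (hX.integrable_exp_mul t)
  have bound := jensen (m / (K + 1))
  have := K.coe_nonneg
  field_simp at bound
  nlinarith [sq_nonneg m]

/-- A sub-Gaussian variable of variance one; it is automatically centred. -/
structure IsUnitSubgaussian (X : Ω → ℝ) (K : ℝ≥0) (μ : Measure Ω) : Prop where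
  hasSubgaussianMGF : HasSubgaussianMGF X K μ
  integral_sq : ∫ ω, X ω ^ 2 ∂μ = 1

namespace IsUnitSubgaussian

lemma pos (hX : IsUnitSubgaussian X K μ) : 0 < K := by
  refine pos_iff_ne_zero.2 fun hK => ?_
  have ae_zero := (hK ▸ hX.hasSubgaussianMGF).ae_eq_zero_of_hasSubgaussianMGF_zero
  have := integral_congr_ae (ae_zero.mono fun ω hω => congrArg (· ^ 2) hω)
  simp [hX.integral_sq] at this

lemma integrable_sq (hX : IsUnitSubgaussian X K μ) : Integrable (fun ω => X ω ^ 2) μ :=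
  (hX.hasSubgaussianMGF.memLp 2).integrable_sq

variable [IsProbabilityMeasure μ]

lemma integrable_exp_sq (hX : IsUnitSubgaussian X K μ) :
    Integrable (fun ω => Real.exp (1 / (4 * K) * X ω ^ 2)) μ := by
  have K_pos := hX.pos
  convert! integrable_exp_mul_sq hX.hasSubgaussianMGF (v := 1 / (2 * K)) (by positivity) ?_ using 3
  · push_cast
    ring
  · push_cast
    field_simp
    norm_num

lemma integral_exp_sq_le (hX : IsUnitSubgaussian X K μ) :
    ∫ ω, Real.exp (1 / (4 * K) * X ω ^ 2) ∂μ ≤ 2 := by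
  have K_pos := hX.pos
  have half : (K : ℝ) * (1 / (2 * K) : ℝ≥0) = 1 / 2 := by
    push_cast
    field_simp
  calc ∫ ω, Real.exp (1 / (4 * K) * X ω ^ 2) ∂μ
      = ∫ ω, Real.exp ((1 / (2 * K) : ℝ≥0) * X ω ^ 2 / 2) ∂μ := by
        congr! 3
        push_cast
        ring
    _ ≤ (√(1 - K * (1 / (2 * K) : ℝ≥0)))⁻¹ :=
        integral_exp_mul_sq_le hX.hasSubgaussianMGF (by positivity) (by rw [half]; norm_num)
    _ ≤ 2 := by
        rw [half, inv_le_comm₀ (by positivity) two_pos, Real.le_sqrt' (by norm_num)]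
        norm_num

-- Compare `1 + X² / (4K) ≤ exp (X² / (4K))` in expectation.
lemma one_div_four_mul_le_one (hX : IsUnitSubgaussian X K μ) : 1 / (4 * K : ℝ) ≤ 1 := by
  have : ∫ ω, (1 / (4 * K) * X ω ^ 2 + 1) ∂μ ≤ 2 :=
    (integral_mono ((hX.integrable_sq.const_mul _).add (integrable_const 1)) hX.integrable_exp_sq
      fun ω => Real.add_one_le_exp _).trans hX.integral_exp_sq_le
  rw [integral_add (hX.integrable_sq.const_mul _) (integrable_const 1), integral_const_mul,
    hX.integral_sq] at this
  simp only [integral_const, probReal_univ, smul_eq_mul] at this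
  linarith

lemma hasSubexponentialMGF_sq_sub_one (hX : IsUnitSubgaussian X K μ) :
    HasSubexponentialMGF (fun ω => X ω ^ 2 - 1) (1536 * K ^ 2) (8 * K) μ := by
  have K_pos : (0 : ℝ) < K := hX.pos
  have := hX.hasSubgaussianMGF.aemeasurable
  have exp_le (ω : Ω) : Real.exp (1 / (4 * K) * |X ω ^ 2 - 1|)
      ≤ Real.exp 1 * Real.exp (1 / (4 * K) * X ω ^ 2) := by
    rw [← Real.exp_add, Real.exp_le_exp]
    have abs_le : |X ω ^ 2 - 1| ≤ 1 + X ω ^ 2 :=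
      abs_le.2 ⟨by nlinarith [sq_nonneg (X ω)], by linarith⟩
    calc 1 / (4 * K) * |X ω ^ 2 - 1| ≤ 1 / (4 * K) * (1 + X ω ^ 2) := by gcongr
      _ ≤ 1 + 1 / (4 * K) * X ω ^ 2 := by linarith [hX.one_div_four_mul_le_one]
  have integrable_bound := hX.integrable_exp_sq.const_mul (Real.exp 1)
  have centred : ∫ ω, (X ω ^ 2 - 1) ∂μ = 0 := by
    rw [integral_sub hX.integrable_sq (integrable_const 1), hX.integral_sq]
    simp
  have integral_le : ∫ ω, Real.exp (1 / (4 * K) * |X ω ^ 2 - 1|) ∂μ ≤ 6 :=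
    calc ∫ ω, Real.exp (1 / (4 * K) * |X ω ^ 2 - 1|) ∂μ
        ≤ ∫ ω, Real.exp 1 * Real.exp (1 / (4 * K) * X ω ^ 2) ∂μ :=
          integral_mono_of_nonneg (ae_of_all _ fun ω => (Real.exp_pos _).le) integrable_bound
            (ae_of_all _ exp_le)
      _ ≤ 3 * 2 := by
          rw [integral_const_mul]
          gcongr
          · linarith [Real.exp_one_lt_d9]
          · exact hX.integral_exp_sq_le
      _ = 6 := by norm_num
  refine (HasSubexponentialMGF.of_integral_exp_mul_abs_le (by positivity) (by fun_prop) centred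
    (integrable_bound.mono' (by fun_prop) (ae_of_all _ fun ω => ?_)) integral_le).mono
      (le_of_eq ?_) (le_of_eq ?_)
  · rw [Real.norm_of_nonneg (Real.exp_pos _).le]
    exact exp_le ω
  · field_simp
    norm_num
  · field_simp
    norm_num

lemma sum_mul {ι : Type*} [Fintype ι] {ξ : ι → Ω → ℝ} (hξ : ∀ i, IsUnitSubgaussian (ξ i) K μ)
    (hindep : iIndepFun ξ μ) {w : ι → ℝ} (hw : ∑ i, w i ^ 2 = 1) :
    IsUnitSubgaussian (fun ω => ∑ i, w i * ξ i ω) K μ := by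
  have hindep' : iIndepFun (fun i ω => w i * ξ i ω) μ :=
    hindep.comp (fun i x => w i * x) fun i => by fun_prop
  have hsub (i : ι) :
      HasSubgaussianMGF (fun ω => w i * ξ i ω) (.mk (w i ^ 2) (sq_nonneg _) * K) μ :=
    (hξ i).hasSubgaussianMGF.const_mul (w i)
  have hasSubgaussianMGF_sum : HasSubgaussianMGF (fun ω => ∑ i, w i * ξ i ω) K μ := by
    convert HasSubgaussianMGF.sum_of_iIndepFun hindep' (s := Finset.univ) fun i _ => hsub i
    apply NNReal.coe_injective
    push_cast
    rw [← Finset.sum_mul, hw, one_mul]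
  refine ⟨hasSubgaussianMGF_sum, ?_⟩
  have integral_sq_eq_variance {Z : Ω → ℝ} {c : ℝ≥0} (hZ : HasSubgaussianMGF Z c μ) :
      ∫ ω, Z ω ^ 2 ∂μ = variance Z μ :=
    (variance_of_integral_eq_zero hZ.aemeasurable (integral_eq_zero_of_hasSubgaussianMGF hZ)).symm
  calc ∫ ω, (∑ i, w i * ξ i ω) ^ 2 ∂μ
      = variance (∑ i, fun ω => w i * ξ i ω) μ := by
        rw [integral_sq_eq_variance hasSubgaussianMGF_sum, Finset.sum_fn]
    _ = ∑ i, variance (fun ω => w i * ξ i ω) μ :=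
        IndepFun.variance_sum (fun i _ => (hsub i).memLp 2) fun i _ j _ hij => hindep'.indepFun hij
    _ = ∑ i, w i ^ 2 := by
        simp only [variance_const_mul, ← integral_sq_eq_variance (hξ _).hasSubgaussianMGF,
          (hξ _).integral_sq, mul_one]
    _ = 1 := hw

end IsUnitSubgaussian

end SubgaussianSquare

section EntryLaws

variable {Ω : Type*} [MeasurableSpace Ω] {μ : Measure Ω} {X : Ω → ℝ} {K : ℝ≥0} {n : ℕ}

namespace IsUnitSubgaussian

lemma mono {K' : ℝ≥0} (hX : IsUnitSubgaussian X K μ) (hK : K ≤ K') : IsUnitSubgaussian X K' μ where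
  hasSubgaussianMGF :=
    ⟨hX.hasSubgaussianMGF.integrable_exp_mul, fun t => (hX.hasSubgaussianMGF.mgf_le t).trans <| by
      gcongr⟩
  integral_sq := hX.integral_sq

lemma comp_hasLaw {ν : Measure ℝ} {f : ℝ → ℝ} {Y : Ω → ℝ} (hf : IsUnitSubgaussian f K ν)
    (hY : HasLaw Y ν μ) : IsUnitSubgaussian (fun ω => f (Y ω)) K μ where
  hasSubgaussianMGF := .of_map hY.aemeasurable (hY.map_eq ▸ hf.hasSubgaussianMGF)
  integral_sq := (hY.integral_comp (f := fun x => f x ^ 2)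
    (hf.hasSubgaussianMGF.aestronglyMeasurable.pow 2)).trans hf.integral_sq

lemma of_abs_le [IsProbabilityMeasure μ] (hX : AEMeasurable X μ) (hXK : ∀ᵐ ω ∂μ, |X ω| ≤ K)
    (hX0 : ∫ ω, X ω ∂μ = 0) (hX2 : ∫ ω, X ω ^ 2 ∂μ = 1) : IsUnitSubgaussian X (K ^ 2) μ where
  hasSubgaussianMGF := by
    convert! hasSubgaussianMGF_of_mem_Icc_of_integral_eq_zero hX
      (hXK.mono fun ω hω => abs_le.1 hω) hX0
    ext
    push_cast
    rw [sub_neg_eq_add, Real.norm_of_nonneg (by positivity), add_self_div_two]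
  integral_sq := hX2

lemma gaussianReal : IsUnitSubgaussian id 1 (gaussianReal 0 1) where
  hasSubgaussianMGF := by
    refine ⟨fun t => integrable_exp_mul_gaussianReal t, fun t => ?_⟩
    rw [mgf_id_gaussianReal]
    simp
  integral_sq := by
    have := variance_of_integral_eq_zero (X := id) (by fun_prop) (integral_id_gaussianReal (v := 1))
    exact this.symm.trans variance_id_gaussianReal

end IsUnitSubgaussian

lemma isProbabilityMeasure_signLaw (n : ℕ) : IsProbabilityMeasure (signLaw n) := by
  constructor
  simp only [signLaw, Measure.add_apply, Measure.smul_apply, measure_univ, smul_eq_mul, mul_one]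
  rw [← ENNReal.ofReal_add (by norm_num) (by norm_num)]
  norm_num

lemma isProbabilityMeasure_sparseSignLaw (n : ℕ) : IsProbabilityMeasure (sparseSignLaw n) := by
  constructor
  simp only [sparseSignLaw, Measure.add_apply, Measure.smul_apply, measure_univ, smul_eq_mul,
    mul_one]
  rw [← ENNReal.ofReal_add (by norm_num) (by norm_num),
    ← ENNReal.ofReal_add (by norm_num) (by norm_num)]
  norm_num

lemma integrable_ofReal_smul_dirac (f : ℝ → ℝ) (c a : ℝ) :
    Integrable f (ENNReal.ofReal c • Measure.dirac a) :=
  (integrable_dirac (by simp)).smul_measure (by simp)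

lemma integral_signLaw (n : ℕ) (f : ℝ → ℝ) :
    ∫ x, f x ∂(signLaw n) = 1 / 2 * f (1 / √(n : ℝ)) + 1 / 2 * f (-(1 / √(n : ℝ))) := by
  rw [signLaw, integral_add_measure (integrable_ofReal_smul_dirac ..)
    (integrable_ofReal_smul_dirac ..)]
  simp [integral_smul_measure]

lemma integral_sparseSignLaw (n : ℕ) (f : ℝ → ℝ) :
    ∫ x, f x ∂(sparseSignLaw n) =
      1 / 6 * f √(3 / (n : ℝ)) + 2 / 3 * f 0 + 1 / 6 * f (-√(3 / (n : ℝ))) := by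
  rw [sparseSignLaw, integral_add_measure ((integrable_ofReal_smul_dirac ..).add_measure
    (integrable_ofReal_smul_dirac ..)) (integrable_ofReal_smul_dirac ..),
    integral_add_measure (integrable_ofReal_smul_dirac ..) (integrable_ofReal_smul_dirac ..)]
  simp only [integral_smul_measure, integral_dirac, smul_eq_mul]
  rw [ENNReal.toReal_ofReal (by norm_num), ENNReal.toReal_ofReal (by norm_num)]

lemma ae_signLaw_abs_sqrt_mul_le (hn : 0 < n) : ∀ᵐ x ∂(signLaw n), |√(n : ℝ) * x| ≤ 1 := by
  have sqrt_ne_zero : √(n : ℝ) ≠ 0 := by positivity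
  rw [signLaw, ae_add_measure_iff]
  constructor <;> refine Measure.ae_smul_measure ?_ _ <;>
    rw [ae_dirac_iff (measurableSet_le (by fun_prop) (by fun_prop))] <;> simp [sqrt_ne_zero]

lemma sqrt_mul_sqrt_div (hn : 0 < n) (a : ℝ) : √(n : ℝ) * √(a / n) = √a := by
  rw [← Real.sqrt_mul (by positivity), mul_div_cancel₀ a (by positivity)]

lemma ae_sparseSignLaw_abs_sqrt_mul_le (hn : 0 < n) :
    ∀ᵐ x ∂(sparseSignLaw n), |√(n : ℝ) * x| ≤ √3 := by
  rw [sparseSignLaw, ae_add_measure_iff, ae_add_measure_iff]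
  refine ⟨⟨?_, ?_⟩, ?_⟩ <;> refine Measure.ae_smul_measure ?_ _ <;>
    rw [ae_dirac_iff (measurableSet_le (by fun_prop) (by fun_prop))] <;>
    simp only [mul_zero, mul_neg, sqrt_mul_sqrt_div hn, abs_neg, Real.sqrt_nonneg,
      abs_of_nonneg, le_refl]

lemma isUnitSubgaussian_signLaw (hn : 0 < n) :
    IsUnitSubgaussian (fun x => √(n : ℝ) * x) 1 (signLaw n) := by
  have := isProbabilityMeasure_signLaw n
  rw [← one_pow 2]
  refine .of_abs_le (by fun_prop) (ae_signLaw_abs_sqrt_mul_le hn) ?_ ?_ <;> rw [integral_signLaw]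
  · ring
  · field_simp
    norm_num

lemma isUnitSubgaussian_sparseSignLaw (hn : 0 < n) :
    IsUnitSubgaussian (fun x => √(n : ℝ) * x) 3 (sparseSignLaw n) := by
  have := isProbabilityMeasure_sparseSignLaw n
  rw [← NNReal.sq_sqrt 3]
  refine .of_abs_le (by fun_prop) (by simpa using ae_sparseSignLaw_abs_sqrt_mul_le hn) ?_ ?_ <;>
    rw [integral_sparseSignLaw]
  · ring
  · rw [mul_neg, sqrt_mul_sqrt_div hn, neg_sq, Real.sq_sqrt (by norm_num)]
    norm_num

lemma isUnitSubgaussian_gaussianReal (hn : 0 < n) :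
    IsUnitSubgaussian (fun x => √(n : ℝ) * x) 1 (gaussianReal 0 (1 / (n : ℝ≥0))) := by
  refine IsUnitSubgaussian.gaussianReal.comp_hasLaw ?_
  convert! gaussianReal_const_mul (HasLaw.id (μ := gaussianReal 0 (1 / (n : ℝ≥0)))) √(n : ℝ)
  · simp
  · apply NNReal.coe_injective
    have : (n : ℝ) ≠ 0 := by positivity
    simp [this]

lemma IsEntryLaw.isUnitSubgaussian {ν : Measure ℝ} {Y : Ω → ℝ} (hν : IsEntryLaw n ν) (hn : 0 < n)
    (hY : HasLaw Y ν μ) : IsUnitSubgaussian (fun ω => √(n : ℝ) * Y ω) 3 μ := by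
  refine IsUnitSubgaussian.comp_hasLaw (f := fun x => √(n : ℝ) * x) ?_ hY
  rcases hν with rfl | rfl | rfl
  · exact (isUnitSubgaussian_gaussianReal hn).mono (by norm_num)
  · exact (isUnitSubgaussian_signLaw hn).mono (by norm_num)
  · exact isUnitSubgaussian_sparseSignLaw hn

end EntryLaws

section Net

variable {E : Type*} [NormedAddCommGroup E] [NormedSpace ℝ E] [FiniteDimensional ℝ E]

-- The balls of radius `ε / 2` around the points are disjoint and lie in the ball of radius
-- `r + ε / 2`, so volumes can be compared.
lemma card_le_of_isSeparated {r ε : ℝ≥0} (hε : 0 < ε) {s : Finset E}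
    (hs : (s : Set E) ⊆ Metric.closedBall 0 r) (hsep : Metric.IsSeparated ε (s : Set E)) :
    (s.card : ℝ) ≤ (1 + 2 * r / ε) ^ Module.finrank ℝ E := by
  borelize E
  let μ : Measure E := Measure.addHaar
  have half_pos : (0 : ℝ) < ε / 2 := by positivity
  have outer_pos : (0 : ℝ) < r + ε / 2 := by positivity
  have disjoint_balls : (s : Set E).PairwiseDisjoint fun c => Metric.ball c (ε / 2 : ℝ) := by
    refine fun c hc d hd hcd => Metric.ball_disjoint_ball ?_
    have lt_edist : ε < edist c d := hsep hc hd hcd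
    rw [edist_nndist, ENNReal.coe_lt_coe] at lt_edist
    rw [add_halves]
    exact_mod_cast lt_edist.le
  have balls_subset : ⋃ c ∈ s, Metric.ball c (ε / 2 : ℝ) ⊆ Metric.ball (0 : E) (r + ε / 2) :=
    Set.iUnion₂_subset fun c hc => Metric.ball_subset_ball' (by
      linarith [Metric.mem_closedBall.1 (hs hc)])
  have volume_le : (s.card : ℝ≥0∞) * ENNReal.ofReal ((ε / 2 : ℝ) ^ Module.finrank ℝ E)
        * μ (Metric.ball 0 1)
      ≤ ENNReal.ofReal ((r + ε / 2 : ℝ) ^ Module.finrank ℝ E) * μ (Metric.ball 0 1) := by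
    rw [← μ.addHaar_ball_of_pos 0 outer_pos, mul_assoc]
    refine le_of_eq_of_le ?_ (measure_mono balls_subset)
    rw [measure_biUnion_finset disjoint_balls fun c _ => measurableSet_ball]
    simp only [μ.addHaar_ball_of_pos _ half_pos, Finset.sum_const, nsmul_eq_mul]
  rw [ENNReal.mul_le_mul_iff_left (Metric.measure_ball_pos _ _ one_pos).ne'
    measure_ball_lt_top.ne] at volume_le
  have card_mul_le := ENNReal.toReal_le_of_le_ofReal (by positivity) volume_le
  rw [ENNReal.toReal_mul, ENNReal.toReal_natCast, ENNReal.toReal_ofReal (by positivity),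
    ← le_div_iff₀ (by positivity), ← div_pow] at card_mul_le
  convert! card_mul_le using 2
  field_simp
  ring

lemma packingNumber_closedBall_le {r ε : ℝ≥0} (hε : 0 < ε) :
    Metric.packingNumber ε (Metric.closedBall (0 : E) r)
      ≤ (⌊(1 + 2 * r / ε : ℝ) ^ Module.finrank ℝ E⌋₊ : ℕ∞) := by
  refine iSup_le fun C => iSup₂_le fun hC hsep => ?_
  by_contra! lt_encard
  obtain ⟨D, hDC, hD⟩ := Set.exists_subset_encard_eq (Order.add_one_le_of_lt lt_encard)
  have D_finite : D.Finite := Set.finite_of_encard_eq_coe hD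
  lift D to Finset E using D_finite
  rw [Set.encard_coe_eq_coe_finsetCard] at hD
  have card_le := Nat.le_floor (card_le_of_isSeparated hε (hDC.trans hC) (hsep.mono hDC))
  have : D.card = ⌊(1 + 2 * r / ε : ℝ) ^ Module.finrank ℝ E⌋₊ + 1 := by exact_mod_cast hD
  omega

lemma exists_finset_isCover_closedBall (r : ℝ≥0) {ε : ℝ≥0} (hε : 0 < ε) :
    ∃ S : Finset E, (S : Set E) ⊆ Metric.closedBall 0 r ∧
      Metric.IsCover ε (Metric.closedBall (0 : E) r) S ∧
      (S.card : ℝ) ≤ (1 + 2 * r / ε) ^ Module.finrank ℝ E := by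
  have packing_ne_top := ne_top_of_le_ne_top (ENat.natCast_ne_top _) (packingNumber_closedBall_le
    (E := E) (r := r) hε)
  have finite : (Metric.maximalSeparatedSet ε (Metric.closedBall (0 : E) r)).Finite := by
    rwa [← Set.encard_ne_top_iff, Metric.encard_maximalSeparatedSet packing_ne_top]
  refine ⟨finite.toFinset, ?_, ?_, card_le_of_isSeparated hε ?_ ?_⟩ <;>
    rw [finite.coe_toFinset]
  · exact Metric.maximalSeparatedSet_subset
  · exact Metric.isCover_maximalSeparatedSet packing_ne_top
  · exact Metric.maximalSeparatedSet_subset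
  · exact Metric.isSeparated_maximalSeparatedSet

end Net

section NearIsometry

variable {E F : Type*} [NormedAddCommGroup E] [InnerProductSpace ℝ E]
  [NormedAddCommGroup F] [InnerProductSpace ℝ F]

lemma one_sub_two_mul_mul_norm_le_of_isCover {T : E →L[ℝ] E} (hT : T.IsSymmetric) {S : Set E}
    {ε : ℝ≥0} (hS : S ⊆ Metric.closedBall (0 : E) 1)
    (hcover : Metric.IsCover ε (Metric.closedBall (0 : E) 1) S)
    {η : ℝ} (hη : ∀ y ∈ S, |inner ℝ (T y) y| ≤ η) : (1 - 2 * ε) * ‖T‖ ≤ η := by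
  have exists_near (x : E) (hx : ‖x‖ ≤ 1) : ∃ y ∈ S, ‖x - y‖ ≤ ε := by
    rw [Metric.isCover_iff_subset_iUnion_closedBall] at hcover
    simpa [dist_eq_norm] using hcover (mem_closedBall_zero_iff.2 hx)
  have le_unit (x : E) (hx : ‖x‖ = 1) : |inner ℝ (T x) x| ≤ η + 2 * ε * ‖T‖ := by
    obtain ⟨y, hy, hxy⟩ := exists_near x hx.le
    have y_norm : ‖y‖ ≤ 1 := mem_closedBall_zero_iff.1 (hS hy)
    have bound {u w : E} : |inner ℝ (T u) w| ≤ ‖T‖ * ‖u‖ * ‖w‖ :=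
      (abs_real_inner_le_norm _ _).trans (by gcongr; exact T.le_opNorm u)
    calc |inner ℝ (T x) x|
        = |inner ℝ (T y) y + inner ℝ (T y) (x - y) + inner ℝ (T (x - y)) x| := by
          rw [map_sub, inner_sub_right, inner_sub_left]
          congr 1
          ring
      _ ≤ |inner ℝ (T y) y| + |inner ℝ (T y) (x - y)| + |inner ℝ (T (x - y)) x| :=
          abs_add_three _ _ _
      _ ≤ η + ‖T‖ * 1 * ε + ‖T‖ * ε * 1 := by
          gcongr
          · exact hη y hy
          · exact bound.trans (by gcongr)
          · exact bound.trans (by rw [hx]; gcongr)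
      _ = η + 2 * ε * ‖T‖ := by ring
  have norm_le : ‖T‖ ≤ η + 2 * ε * ‖T‖ := by
    have η_nonneg : 0 ≤ η := by
      obtain ⟨y, hy, -⟩ := exists_near 0 (by simp)
      exact (abs_nonneg _).trans (hη y hy)
    rw [T.norm_eq_iSup_rayleighQuotient hT]
    refine ciSup_le fun x => ?_
    rw [← T.norm_eq_iSup_rayleighQuotient hT]
    rcases eq_or_ne x 0 with rfl | hx
    · simpa using by positivity
    · have unit : ‖(‖x‖⁻¹ : ℝ) • x‖ = 1 := norm_smul_inv_norm hx
      rw [← T.rayleigh_smul x (c := (‖x‖⁻¹ : ℝ)) (by simpa using hx),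
        ContinuousLinearMap.rayleighQuotient, ContinuousLinearMap.reApplyInnerSelf_apply]
      simpa only [unit, one_pow, div_one, RCLike.re_to_real] using le_unit _ unit
  linarith

lemma abs_norm_sq_sub_norm_sq_le_of_isCover [CompleteSpace E] [CompleteSpace F] (A : E →L[ℝ] F)
    {S : Set E} (hS : S ⊆ Metric.closedBall 0 1)
    (hcover : Metric.IsCover (1 / 4) (Metric.closedBall 0 1) S) {δ : ℝ}
    (hA : ∀ y ∈ S, |‖A y‖ ^ 2 - ‖y‖ ^ 2| ≤ δ / 2) (x : E) :
    |‖A x‖ ^ 2 - ‖x‖ ^ 2| ≤ δ * ‖x‖ ^ 2 := by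
  set T : E →L[ℝ] E := A.adjoint ∘L A - 1 with T_def
  have T_symm : T.IsSymmetric := by
    rw [← ContinuousLinearMap.isSelfAdjoint_iff_isSymmetric]
    exact (ContinuousLinearMap.isPositive_adjoint_comp_self A).isSelfAdjoint.sub (.one _)
  have inner_T (y : E) : inner ℝ (T y) y = ‖A y‖ ^ 2 - ‖y‖ ^ 2 := by
    simp [T_def, inner_sub_left, ContinuousLinearMap.adjoint_inner_left]
  have norm_T : ‖T‖ ≤ δ := by
    have := one_sub_two_mul_mul_norm_le_of_isCover T_symm hS hcover fun y hy => by
      rw [inner_T]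
      exact hA y hy
    norm_num at this
    linarith
  calc |‖A x‖ ^ 2 - ‖x‖ ^ 2| = |inner ℝ (T x) x| := by rw [inner_T]
    _ ≤ ‖T‖ * ‖x‖ * ‖x‖ := (abs_real_inner_le_norm _ _).trans (by gcongr; exact T.le_opNorm x)
    _ ≤ δ * ‖x‖ ^ 2 := by
        rw [mul_assoc, ← sq]
        gcongr

end NearIsometry

section Counting

lemma card_filter_card_le (V : Type*) [Fintype V] {s : ℕ} (hs : 0 < s)
    (hsV : s ≤ Fintype.card V) :
    ((Finset.univ.filter fun T : Finset V => T.card ≤ s).card : ℝ) ≤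
      (Real.exp 1 * (Fintype.card V / s)) ^ s := by
  set N := Fintype.card V with N_def
  have s_pos : (0 : ℝ) < s := by exact_mod_cast hs
  have N_pos : (0 : ℝ) < N := by exact_mod_cast hs.trans_le hsV
  have one_le_ratio : 1 ≤ (N : ℝ) / s := by
    rw [one_le_div s_pos]
    exact_mod_cast hsV
  have one_le_weight {t : ℕ} (ht : t ≤ s) : 1 ≤ ((N : ℝ) / s) ^ s * ((s : ℝ) / N) ^ t := by
    rw [← inv_div (N : ℝ) s, inv_pow, ← pow_sub₀ _ (by positivity) ht]
    exact one_le_pow₀ one_le_ratio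
  have sum_weight : ∑ T : Finset V, ((s : ℝ) / N) ^ T.card = (1 + s / N) ^ N := by
    classical
    simpa [N_def, div_pow] using
      (Finset.prod_one_add (f := fun _ : V => (s : ℝ) / N) Finset.univ).symm
  calc ((Finset.univ.filter fun T : Finset V => T.card ≤ s).card : ℝ)
      ≤ ∑ T : Finset V with T.card ≤ s, ((N : ℝ) / s) ^ s * ((s : ℝ) / N) ^ T.card := by
        rw [Finset.cast_card]
        exact Finset.sum_le_sum fun T hT => one_le_weight (Finset.mem_filter.1 hT).2
    _ ≤ ∑ T : Finset V, ((N : ℝ) / s) ^ s * ((s : ℝ) / N) ^ T.card :=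
        Finset.sum_le_sum_of_subset_of_nonneg (Finset.filter_subset _ _) fun _ _ _ => by positivity
    _ = ((N : ℝ) / s) ^ s * (1 + s / N) ^ N := by rw [← Finset.mul_sum, sum_weight]
    _ ≤ ((N : ℝ) / s) ^ s * Real.exp (s / N) ^ N := by
        gcongr
        rw [add_comm]
        exact Real.add_one_le_exp _
    _ = (Real.exp 1 * (N / s)) ^ s := by
        rw [← Real.exp_nat_mul, mul_pow, ← Real.exp_nat_mul, mul_comm]
        congr 2
        field_simp

end Counting

section Colouring

lemma colorable_of_degree_le {V : Type*} [Fintype V] (G : SimpleGraph V) [DecidableRel G.Adj]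
    {D : ℕ} (hG : ∀ v, G.degree v ≤ D) : G.Colorable (D + 1) := by
  classical
  suffices ∀ s : Finset V, ∃ f : V → Fin (D + 1), ∀ x ∈ s, ∀ y ∈ s, G.Adj x y → f x ≠ f y by
    obtain ⟨f, hf⟩ := this Finset.univ
    exact ⟨.mk f fun {x y} => hf x (Finset.mem_univ _) y (Finset.mem_univ _)⟩
  intro s
  induction s using Finset.induction_on with
  | empty => exact ⟨fun _ => 0, by simp⟩
  | insert a s ha ih =>
    obtain ⟨f, hf⟩ := ih
    obtain ⟨c, hc⟩ : ∃ c, c ∉ (G.neighborFinset a).image f := by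
      by_contra! hall
      have : Fintype.card (Fin (D + 1)) ≤ D :=
        (Finset.card_le_card fun c _ => hall c).trans (Finset.card_image_le.trans (hG a))
      simp at this
    have c_ne {y : V} (hy : G.Adj a y) : c ≠ f y := fun h =>
      hc (Finset.mem_image.2 ⟨y, (G.mem_neighborFinset a y).2 hy, h.symm⟩)
    have ne_a {x : V} (hx : x ∈ s) : x ≠ a := ne_of_mem_of_not_mem hx ha
    refine ⟨Function.update f a c, fun x hx y hy hxy => ?_⟩
    rcases Finset.mem_insert.1 hx with rfl | hxs <;> rcases Finset.mem_insert.1 hy with rfl | hys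
    · exact absurd hxy G.irrefl
    · simpa [ne_a hys] using c_ne hxy
    · simpa [ne_a hxs] using (c_ne hxy.symm).symm
    · simpa [ne_a hxs, ne_a hys] using hf x hxs y hys hxy

variable {ι τ P : Type*}

/-- The graph on the rows of the pattern `p` joining two rows that share an entry: rows that are
pairwise non-adjacent in it are independent once the entries are. -/
def conflictGraph (p : ι → τ → P) : SimpleGraph ι :=
  SimpleGraph.fromRel fun i j => ∃ t t', p i t = p j t'

lemma conflictGraph_adj {p : ι → τ → P} {i j : ι} :
    (conflictGraph p).Adj i j ↔ i ≠ j ∧ ∃ t t', p i t = p j t' := by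
  rw [conflictGraph, SimpleGraph.fromRel_adj]
  refine and_congr_right fun _ => or_iff_left_of_imp ?_
  rintro ⟨t, t', h⟩
  exact ⟨t', t, h.symm⟩

-- A neighbour `j` of `i` is determined by the columns `t ≠ t'` with `p i t = p j t'`.
lemma degree_conflictGraph_le [Fintype ι] [Fintype τ] {p : ι → τ → P}
    [DecidableRel (conflictGraph p).Adj] (hp : ∀ t, Function.Injective fun i => p i t) (i : ι) :
    (conflictGraph p).degree i ≤ Fintype.card τ * (Fintype.card τ - 1) := by
  classical
  have shared (j : (conflictGraph p).neighborFinset i) : ∃ t t', p i t = p j t' :=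
    (conflictGraph_adj.1 ((SimpleGraph.mem_neighborFinset ..).1 j.2)).2
  have ne (j : (conflictGraph p).neighborFinset i) : i ≠ j :=
    (conflictGraph_adj.1 ((SimpleGraph.mem_neighborFinset ..).1 j.2)).1
  choose t t' h using shared
  rw [← SimpleGraph.card_neighborFinset_eq_degree, Nat.mul_sub_one, ← Finset.card_univ (α := τ),
    ← Finset.offDiag_card, ← Fintype.card_coe, ← Fintype.card_coe Finset.univ.offDiag]
  refine Fintype.card_le_of_injective (fun j => ⟨(t j, t' j), ?_⟩) fun j j' hjj' => ?_
  · refine Finset.mem_offDiag.2 ⟨Finset.mem_univ _, Finset.mem_univ _, fun htt' => ne j ?_⟩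
    exact hp (t j) ((h j).trans (congrArg (p j) htt'.symm))
  · obtain ⟨ht, ht'⟩ := Prod.ext_iff.1 (Subtype.ext_iff.1 hjj')
    refine Subtype.ext (hp (t' j) ?_)
    calc p j (t' j) = p i (t j) := (h j).symm
      _ = p i (t j') := by rw [show t j = t j' from ht]
      _ = p j' (t' j') := h j'
      _ = p j' (t' j) := by rw [show t' j = t' j' from ht']

lemma conflictGraph_colorable [Finite ι] [Fintype τ] {p : ι → τ → P}
    (hp : ∀ t, Function.Injective fun i => p i t) :
    (conflictGraph p).Colorable (Fintype.card τ * (Fintype.card τ - 1) + 1) := by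
  classical
  have := Fintype.ofFinite ι
  exact colorable_of_degree_le _ (degree_conflictGraph_le hp)

end Colouring

section PatternMatrix

variable {Ω : Type*} [MeasurableSpace Ω] {μ : Measure Ω} {ι κ τ P C : Type*}

lemma iIndepFun_curry [Countable ι] [Countable τ] {X : ι × τ → Ω → ℝ}
    (hX : ∀ q, AEMeasurable (X q) μ) (hindep : iIndepFun X μ) :
    iIndepFun (fun i ω t => X (i, t) ω) μ := by
  have := hindep.isProbabilityMeasure
  have (i : ι) (t : τ) : IsProbabilityMeasure (μ.map (X (i, t))) :=
    Measure.isProbabilityMeasure_map (hX (i, t))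
  have hrow (i : ι) : AEMeasurable (fun ω t => X (i, t) ω) μ :=
    aemeasurable_pi_iff.2 fun t => hX (i, t)
  have row_law (i : ι) : μ.map (fun ω t => X (i, t) ω) =
      Measure.infinitePi fun t => μ.map (X (i, t)) :=
    (hindep.precomp (Prod.mk_right_injective i)).map_fun_eq_infinitePi_map₀' fun t => hX (i, t)
  rw [iIndepFun_iff_map_fun_eq_infinitePi_map₀' hrow]
  simp only [row_law]
  rw [← Measure.infinitePi_map_curry fun i t => μ.map (X (i, t)),
    ← hindep.map_fun_eq_infinitePi_map₀' hX, AEMeasurable.map_map_of_aemeasurable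
      (MeasurableEquiv.curry ι τ ℝ).measurable.aemeasurable (aemeasurable_pi_iff.2 hX)]
  rfl

/-- The matrix whose entry in position `(i, t)` is the variable `x (p i t)`: the pattern `p` records
which entries are repeated. -/
def patternMatrix (p : ι → τ → P) (x : P → ℝ) : Matrix ι τ ℝ :=
  Matrix.of fun i t => x (p i t)

variable [Fintype τ] {ξ : P → Ω → ℝ} {K : ℝ≥0} {p : ι → τ → P}

lemma isUnitSubgaussian_patternMatrix_mulVec [IsProbabilityMeasure μ]
    (hξ : ∀ q, IsUnitSubgaussian (ξ q) K μ) (hindep : iIndepFun ξ μ) {i : ι}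
    (hp : Function.Injective (p i)) {w : τ → ℝ} (hw : ∑ t, w t ^ 2 = 1) :
    IsUnitSubgaussian (fun ω => (patternMatrix p (ξ · ω)).mulVec w i) K μ := by
  convert! IsUnitSubgaussian.sum_mul (fun t => hξ (p i t)) (hindep.precomp hp) hw using 2 with ω
  exact Finset.sum_congr rfl fun t _ => mul_comm _ _

lemma iIndepFun_patternMatrix_mulVec [Countable ι] (hξ : ∀ q, AEMeasurable (ξ q) μ)
    (hindep : iIndepFun ξ μ) (hp : ∀ i, Function.Injective (p i))
    (f : (conflictGraph p).Coloring C) (w : τ → ℝ) (c : C) :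
    iIndepFun (fun (i : {i // f i = c}) ω => (patternMatrix p (ξ · ω)).mulVec w i) μ := by
  have class_injective :
      Function.Injective fun q : {i // f i = c} × τ => p q.1 q.2 := by
    rintro ⟨i, t⟩ ⟨j, t'⟩ h
    obtain rfl : i = j := by
      by_contra hij
      exact f.valid (conflictGraph_adj.2 ⟨Subtype.coe_ne_coe.2 hij, t, t', h⟩)
        (i.2.trans j.2.symm)
    exact congrArg (Prod.mk i) (hp i h)
  exact (iIndepFun_curry (fun q => hξ _) (hindep.precomp class_injective)).comp
    (fun _ x => ∑ t, x t * w t) fun _ => by fun_prop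

lemma measureReal_le_abs_sum_sq_sub_one_le [IsProbabilityMeasure μ] [Fintype ι] [Nonempty ι]
    [Fintype C] (hξ : ∀ q, IsUnitSubgaussian (ξ q) K μ) (hindep : iIndepFun ξ μ)
    (hp : ∀ i, Function.Injective (p i)) (f : (conflictGraph p).Coloring C) {w : τ → ℝ}
    (hw : ∑ t, w t ^ 2 = 1) {ε : ℝ} (hε : 0 ≤ ε) (hε' : ε ≤ 1) :
    μ.real {ω | ε * Fintype.card ι ≤ |∑ i, ((patternMatrix p (ξ · ω)).mulVec w i ^ 2 - 1)|} ≤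
      2 * Real.exp (-(ε ^ 2 / (3072 * K ^ 2) * (Fintype.card ι / Fintype.card C))) := by
  have row (i : ι) := isUnitSubgaussian_patternMatrix_mulVec hξ hindep (hp i) hw
  obtain ⟨i₀⟩ := ‹Nonempty ι›
  have : Nonempty C := ⟨f i₀⟩
  have K_pos : (0 : ℝ) < K := (row i₀).pos
  have one_le_K : 1 ≤ 4 * (K : ℝ) := (div_le_one (by positivity)).1 (row i₀).one_div_four_mul_le_one
  have sum_subexponential := HasSubexponentialMGF.sum_of_coloring f (v := 1536 * K ^ 2)
    (b := 8 * K) (by positivity) (by positivity)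
    (fun c => (iIndepFun_patternMatrix_mulVec (fun q => (hξ q).hasSubgaussianMGF.aemeasurable)
      hindep hp f w c).comp (fun _ x => x ^ 2 - 1) fun _ => by fun_prop)
    (fun i => (row i).hasSubexponentialMGF_sq_sub_one)
  refine (sum_subexponential.measureReal_le_abs_le (by positivity) (by positivity) ?_).trans_eq ?_
  · calc ε * Fintype.card ι * (2 * Fintype.card C * (8 * K))
        = Fintype.card ι * Fintype.card C * (16 * K * ε) := by ring
      _ ≤ Fintype.card ι * Fintype.card C * (1536 * K ^ 2) :=
          mul_le_mul_of_nonneg_left (by nlinarith) (by positivity)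
  · congr 2
    field_simp
    ring

end PatternMatrix

section RestrictedIsometry

variable {Ω : Type*} [MeasurableSpace Ω] {μ : Measure Ω} [IsProbabilityMeasure μ]
  {ι κ τ P C : Type*} [Fintype ι] {X : P → Ω → ℝ} {K : ℝ≥0} {δ : ℝ}

lemma SatisfiesRIP.mono {A : Matrix ι κ ℝ} {s : ℕ} {δ' : ℝ} (hA : SatisfiesRIP A s δ)
    (hδ : δ ≤ δ') : SatisfiesRIP A s δ' := fun T hT z => by
  refine ⟨le_trans ?_ (hA T hT z).1, (hA T hT z).2.trans ?_⟩ <;> gcongr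

lemma satisfiesRIP_of_abs_le {A : Matrix ι κ ℝ} {s : ℕ}
    (hA : ∀ T : Finset κ, T.card ≤ s → ∀ z : EuclideanSpace ℝ T,
      |‖WithLp.toLp 2 ((A.submatrix id (fun t : T => (t : κ))).mulVec z.ofLp)‖ ^ 2 - ‖z‖ ^ 2| ≤
        δ * ‖z‖ ^ 2) : SatisfiesRIP A s δ := fun T hT z => by
  have := abs_le.1 (hA T hT z)
  constructor <;> linarith

lemma sum_sq_sqrt_card_smul_mulVec_sub_one [Fintype τ] (A : Matrix ι τ ℝ)
    {z : EuclideanSpace ℝ τ} (hz : z ≠ 0) :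
    ∑ i, ((√(Fintype.card ι : ℝ) • A).mulVec (fun t => z t / ‖z‖) i ^ 2 - 1) =
      Fintype.card ι / ‖z‖ ^ 2 * (‖WithLp.toLp 2 (A.mulVec z.ofLp)‖ ^ 2 - ‖z‖ ^ 2) := by
  have z_ne : ‖z‖ ^ 2 ≠ 0 := pow_ne_zero 2 (norm_ne_zero_iff.2 hz)
  have row (i : ι) : (√(Fintype.card ι : ℝ) • A).mulVec (fun t => z t / ‖z‖) i ^ 2 =
      Fintype.card ι / ‖z‖ ^ 2 * A.mulVec z.ofLp i ^ 2 := by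
    have : (fun t => z t / ‖z‖) = ‖z‖⁻¹ • z.ofLp := funext fun t => div_eq_inv_mul _ _
    rw [this, Matrix.smul_mulVec, Matrix.mulVec_smul, Pi.smul_apply, Pi.smul_apply, smul_eq_mul,
      smul_eq_mul, mul_pow, mul_pow, Real.sq_sqrt (Nat.cast_nonneg _), inv_pow]
    ring
  rw [mul_sub, div_mul_cancel₀ _ z_ne,
    EuclideanSpace.real_norm_sq_eq (WithLp.toLp 2 (A.mulVec z.ofLp)), Finset.mul_sum,
    Finset.sum_sub_distrib]
  simp only [row, Finset.sum_const, Finset.card_univ, nsmul_eq_mul, mul_one]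

lemma measureReal_lt_abs_norm_sq_sub_norm_sq_le [Fintype τ] [Nonempty ι] [Fintype C]
    {p : ι → τ → P} (hX : ∀ q, IsUnitSubgaussian (fun ω => √(Fintype.card ι : ℝ) * X q ω) K μ)
    (hindep : iIndepFun X μ) (hp : ∀ i, Function.Injective (p i))
    (f : (conflictGraph p).Coloring C) (z : EuclideanSpace ℝ τ) {ε : ℝ} (hε : 0 ≤ ε)
    (hε' : ε ≤ 1) :
    μ.real {ω | ε * ‖z‖ ^ 2 <
      |‖WithLp.toLp 2 ((patternMatrix p (X · ω)).mulVec z.ofLp)‖ ^ 2 - ‖z‖ ^ 2|} ≤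
      2 * Real.exp (-(ε ^ 2 / (3072 * K ^ 2) * (Fintype.card ι / Fintype.card C))) := by
  rcases eq_or_ne z 0 with rfl | hz
  · simp only [norm_zero, WithLp.ofLp_zero, Matrix.mulVec_zero, WithLp.toLp_zero, ne_eq,
      OfNat.ofNat_ne_zero, not_false_eq_true, zero_pow, mul_zero, sub_zero, abs_zero,
      lt_self_iff_false, Set.ofPred_false, measureReal_empty]
    positivity
  have : 0 < ‖z‖ := norm_pos_iff.2 hz
  have sum_weights : ∑ t, (z t / ‖z‖) ^ 2 = 1 := by
    simp only [div_pow, ← Finset.sum_div, ← EuclideanSpace.real_norm_sq_eq]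
    exact div_self (by positivity)
  have hindep' : iIndepFun (fun q ω => √(Fintype.card ι : ℝ) * X q ω) μ :=
    hindep.comp (fun _ x => √(Fintype.card ι : ℝ) * x) fun _ => by fun_prop
  refine le_trans (measureReal_mono fun ω hω => ?_)
    (measureReal_le_abs_sum_sq_sub_one_le hX hindep' hp f sum_weights hε hε')
  rw [Set.mem_ofPred_eq] at hω ⊢
  change _ ≤ |∑ i, ((√(Fintype.card ι : ℝ) • patternMatrix p (X · ω)).mulVec _ i ^ 2 - 1)|
  rw [sum_sq_sqrt_card_smul_mulVec_sub_one _ hz, abs_mul, abs_of_nonneg (by positivity)]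
  calc ε * Fintype.card ι = Fintype.card ι / ‖z‖ ^ 2 * (ε * ‖z‖ ^ 2) := by field_simp
    _ ≤ _ := by gcongr

lemma measureReal_not_forall_abs_norm_sq_sub_norm_sq_le [Fintype τ] [Nonempty ι] [Fintype C]
    {p : ι → τ → P} (hX : ∀ q, IsUnitSubgaussian (fun ω => √(Fintype.card ι : ℝ) * X q ω) K μ)
    (hindep : iIndepFun X μ) (hp : ∀ i, Function.Injective (p i))
    (f : (conflictGraph p).Coloring C) (hδ : 0 ≤ δ) (hδ' : δ ≤ 1) :
    μ.real {ω | ¬ ∀ z : EuclideanSpace ℝ τ,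
      |‖WithLp.toLp 2 ((patternMatrix p (X · ω)).mulVec z.ofLp)‖ ^ 2 - ‖z‖ ^ 2| ≤ δ * ‖z‖ ^ 2} ≤
      9 ^ Fintype.card τ *
        (2 * Real.exp (-(δ ^ 2 / (12288 * K ^ 2) * (Fintype.card ι / Fintype.card C)))) := by
  classical
  obtain ⟨S, hS, hcover, hcard⟩ :=
    exists_finset_isCover_closedBall (E := EuclideanSpace ℝ τ) 1 (ε := 1 / 4) (by norm_num)
  let bad (z : EuclideanSpace ℝ τ) : Set Ω := {ω | δ / 2 * ‖z‖ ^ 2 <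
    |‖WithLp.toLp 2 ((patternMatrix p (X · ω)).mulVec z.ofLp)‖ ^ 2 - ‖z‖ ^ 2|}
  have subset_bad : {ω | ¬ ∀ z : EuclideanSpace ℝ τ,
      |‖WithLp.toLp 2 ((patternMatrix p (X · ω)).mulVec z.ofLp)‖ ^ 2 - ‖z‖ ^ 2| ≤ δ * ‖z‖ ^ 2} ⊆
      ⋃ y ∈ S, bad y := by
    refine fun ω hω => by_contra fun hgood => hω fun z => ?_
    simp only [Set.mem_iUnion, not_exists] at hgood
    refine abs_norm_sq_sub_norm_sq_le_of_isCover
      (LinearMap.toContinuousLinearMap (Matrix.toEuclideanLin (patternMatrix p (X · ω))))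
      hS hcover (fun y hy => (not_lt.1 (hgood y hy)).trans ?_) z
    exact mul_le_of_le_one_right (by positivity)
      (pow_le_one₀ (norm_nonneg _) (mem_closedBall_zero_iff.1 (hS hy)))
  have card_le : (S.card : ℝ) ≤ 9 ^ Fintype.card τ := by
    refine hcard.trans_eq ?_
    rw [finrank_euclideanSpace]
    norm_num
  calc _ ≤ μ.real (⋃ y ∈ S, bad y) := measureReal_mono subset_bad (measure_ne_top _ _)
    _ ≤ ∑ y ∈ S, μ.real (bad y) := measureReal_biUnion_finset_le _ _
    _ ≤ ∑ _y ∈ S, 2 * Real.exp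
          (-((δ / 2) ^ 2 / (3072 * K ^ 2) * (Fintype.card ι / Fintype.card C))) :=
        Finset.sum_le_sum fun y _ => measureReal_lt_abs_norm_sq_sub_norm_sq_le hX hindep hp f y
          (by positivity) (by linarith)
    _ = S.card * (2 * Real.exp
          (-(δ ^ 2 / (12288 * K ^ 2) * (Fintype.card ι / Fintype.card C)))) := by
        rw [Finset.sum_const, nsmul_eq_mul]
        congr 5
        ring
    _ ≤ _ := by gcongr

lemma measureReal_not_satisfiesRIP_patternMatrix_le [Fintype κ] [Nonempty ι]
    {p : ι → κ → P} (hX : ∀ q, IsUnitSubgaussian (fun ω => √(Fintype.card ι : ℝ) * X q ω) K μ)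
    (hindep : iIndepFun X μ) (hp : ∀ i, Function.Injective (p i)) {s χ : ℕ} (hs : 0 < s)
    (hsκ : s ≤ Fintype.card κ)
    (hcol : ∀ T : Finset κ, T.card ≤ s → (conflictGraph fun i (t : T) => p i t).Colorable χ)
    (hδ : 0 ≤ δ) (hδ' : δ ≤ 1) :
    μ.real {ω | ¬ SatisfiesRIP (patternMatrix p (X · ω)) s δ} ≤
      (Real.exp 1 * (Fintype.card κ / s)) ^ s *
        (9 ^ s * (2 * Real.exp (-(δ ^ 2 / (12288 * K ^ 2) * (Fintype.card ι / χ))))) := by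
  let bad (T : Finset κ) : Set Ω := {ω | ¬ ∀ z : EuclideanSpace ℝ T,
    |‖WithLp.toLp 2 ((patternMatrix (fun i (t : T) => p i t) (X · ω)).mulVec z.ofLp)‖ ^ 2
      - ‖z‖ ^ 2| ≤ δ * ‖z‖ ^ 2}
  let supports : Finset (Finset κ) := {T | T.card ≤ s}
  set β := 2 * Real.exp (-(δ ^ 2 / (12288 * K ^ 2) * (Fintype.card ι / χ)))
  have : 0 ≤ β := by positivity
  have subset_bad : {ω | ¬ SatisfiesRIP (patternMatrix p (X · ω)) s δ} ⊆
      ⋃ T ∈ supports, bad T := by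
    refine fun ω hω => by_contra fun hgood => hω (satisfiesRIP_of_abs_le fun T hT => ?_)
    simp only [Set.mem_iUnion, not_exists] at hgood
    exact not_not.1 (hgood T (by simpa [supports] using hT))
  have bad_le {T : Finset κ} (hT : T.card ≤ s) : μ.real (bad T) ≤ 9 ^ s * β := by
    obtain ⟨f⟩ := hcol T hT
    have := measureReal_not_forall_abs_norm_sq_sub_norm_sq_le hX hindep
      (fun i => (hp i).comp Subtype.val_injective) f hδ hδ'
    rw [Fintype.card_fin, Fintype.card_coe] at this
    exact this.trans (by gcongr; norm_num)
  calc _ ≤ μ.real (⋃ T ∈ supports, bad T) := measureReal_mono subset_bad (measure_ne_top _ _)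
    _ ≤ ∑ T ∈ supports, μ.real (bad T) := measureReal_biUnion_finset_le _ _
    _ ≤ ∑ _T ∈ supports, 9 ^ s * β :=
        Finset.sum_le_sum fun T hT => bad_le (Finset.mem_filter.1 hT).2
    _ = supports.card * (9 ^ s * β) := by rw [Finset.sum_const, nsmul_eq_mul]
    _ ≤ _ := by
        gcongr
        exact card_filter_card_le κ hs hsκ

lemma pow_mul_nine_pow_mul_two_mul_exp_neg_le {m N : ℕ} (hm : 1 ≤ m) (hN : 3 * m ≤ N) {x : ℝ}
    (hx : 26 * (m * Real.log (N / m)) ≤ x) :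
    (Real.exp 1 * (N / (3 * m : ℕ))) ^ (3 * m) * (9 ^ (3 * m) * (2 * Real.exp (-x))) ≤
      Real.exp (-(x / 2)) := by
  have m_pos : (0 : ℝ) < m := by exact_mod_cast hm
  have one_le_m : (1 : ℝ) ≤ m := by exact_mod_cast hm
  have three_le_ratio : (3 : ℝ) ≤ N / m := by
    rw [le_div_iff₀ m_pos]
    exact_mod_cast hN
  set L := Real.log (N / m)
  have exp_L : Real.exp L = N / m := Real.exp_log (by linarith)
  have one_le_L : 1 ≤ L :=
    (Real.le_log_iff_exp_le (by linarith)).2 (by linarith [Real.exp_one_lt_three])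
  have supports_le : Real.exp 1 * (N / (3 * m : ℕ)) ≤ Real.exp L := by
    calc Real.exp 1 * (N / (3 * m : ℕ)) ≤ 3 * (N / (3 * m : ℕ)) := by
          gcongr
          exact Real.exp_one_lt_three.le
      _ = Real.exp L := by
          rw [exp_L]
          push_cast
          field_simp
  have nine_le : (9 : ℝ) ≤ Real.exp (3 * L) := by
    have : Real.exp (3 * L) = Real.exp L ^ 3 := by rw [← Real.exp_nat_mul]; norm_num
    rw [this, exp_L]
    calc (9 : ℝ) ≤ 3 ^ 3 := by norm_num
      _ ≤ _ := by gcongr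
  have two_le : (2 : ℝ) ≤ Real.exp (m * L) := by
    linarith [Real.add_one_le_exp (m * L), one_le_mul_of_one_le_of_one_le one_le_m one_le_L]
  calc _ ≤ Real.exp L ^ (3 * m) *
          (Real.exp (3 * L) ^ (3 * m) * (Real.exp (m * L) * Real.exp (-x))) := by gcongr
    _ = Real.exp (13 * (m * L) - x) := by
        simp only [← Real.exp_nat_mul, ← Real.exp_add]
        push_cast
        ring_nf
    _ ≤ _ := Real.exp_le_exp.2 (by linarith)

lemma le_measureReal_satisfiesRIP_patternMatrix [Fintype κ] {n N m χ : ℕ}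
    (hn : Fintype.card ι = n) (hN : Fintype.card κ = N) {p : ι → κ → P}
    (hX : ∀ q, IsUnitSubgaussian (fun ω => √(n : ℝ) * X q ω) K μ) (hindep : iIndepFun X μ)
    (hp : ∀ i, Function.Injective (p i)) (hn_pos : 0 < n) (hm : 1 ≤ m) (hmN : 3 * m ≤ N)
    (hcol : ∀ T : Finset κ, T.card ≤ 3 * m → (conflictGraph fun i (t : T) => p i t).Colorable χ)
    (hδ : 0 ≤ δ) (hδ' : δ ≤ 1)
    (hχ : 26 * (m * Real.log (N / m)) ≤ δ ^ 2 / (12288 * K ^ 2) * (n / χ)) :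
    1 - Real.exp (-(δ ^ 2 / (12288 * K ^ 2) * (n / χ) / 2)) ≤
      μ.real {ω | SatisfiesRIP (patternMatrix p (X · ω)) (3 * m) δ} := by
  subst hn hN
  have : Nonempty ι := Fintype.card_pos_iff.1 hn_pos
  have failure_le := (measureReal_not_satisfiesRIP_patternMatrix_le hX hindep hp (s := 3 * m)
    (by lia) hmN hcol hδ hδ').trans (pow_mul_nine_pow_mul_two_mul_exp_neg_le hm hmN hχ)
  have one_le : 1 ≤ μ.real {ω | SatisfiesRIP (patternMatrix p (X · ω)) (3 * m) δ} +
      μ.real {ω | ¬ SatisfiesRIP (patternMatrix p (X · ω)) (3 * m) δ} := by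
    refine le_trans ?_ (measureReal_union_le _ _)
    rw [← probReal_univ (μ := μ)]
    exact measureReal_mono fun ω _ => em _
  linarith

end RestrictedIsometry

section CirculantBlock

variable {l k d e : ℕ}

/-- The index of the block entry found in row `i` and column `t` of `circulantBlock l k B`. -/
def entryIndex (i : Fin l × Fin d) (t : Fin k × Fin e) : ZMod k × Fin d × Fin e :=
  (((i.1 : ℕ) : ZMod k) - ((t.1 : ℕ) : ZMod k), i.2, t.2)

lemma circulantBlock_eq_patternMatrix (b : ZMod k → Matrix (Fin d) (Fin e) ℝ) :
    circulantBlock l k b = patternMatrix entryIndex fun q => b q.1 q.2.1 q.2.2 :=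
  rfl

lemma natCast_fin_injective (hlk : l ≤ k) :
    Function.Injective fun r : Fin l => ((r : ℕ) : ZMod k) := fun r r' h => by
  rw [ZMod.natCast_eq_natCast_iff', Nat.mod_eq_of_lt (r.2.trans_le hlk),
    Nat.mod_eq_of_lt (r'.2.trans_le hlk)] at h
  exact Fin.ext h

lemma entryIndex_injective (i : Fin l × Fin d) :
    Function.Injective (entryIndex (k := k) (e := e) i) := by
  rintro ⟨c, b⟩ ⟨c', b'⟩ h
  simp only [entryIndex, Prod.mk.injEq, sub_right_inj, true_and] at h
  exact Prod.ext (natCast_fin_injective le_rfl h.1) h.2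

lemma entryIndex_left_injective (hlk : l ≤ k) (t : Fin k × Fin e) :
    Function.Injective fun i : Fin l × Fin d => entryIndex i t := by
  rintro ⟨r, a⟩ ⟨r', a'⟩ h
  simp only [entryIndex, Prod.mk.injEq, sub_left_inj, and_true] at h
  exact Prod.ext (natCast_fin_injective hlk h.1) h.2

-- Two rows sharing a block entry have the same position within their blocks.
lemma conflictGraph_entryIndex_colorable_block (T : Finset (Fin k × Fin e)) :
    (conflictGraph fun (i : Fin l × Fin d) (t : T) =>
      entryIndex i (t : Fin k × Fin e)).Colorable l := by
  refine ⟨.mk Prod.fst fun {i j} hij hr => ?_⟩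
  obtain ⟨hne, t, t', h⟩ := conflictGraph_adj.1 hij
  simp only [entryIndex, Prod.mk.injEq] at h
  exact hne (Prod.ext hr h.2.1)

lemma conflictGraph_entryIndex_colorable (hlk : l ≤ k) {m : ℕ} {T : Finset (Fin k × Fin e)}
    (hT : T.card ≤ 3 * m) (hm : 1 ≤ m) :
    (conflictGraph fun (i : Fin l × Fin d) (t : T) =>
      entryIndex i (t : Fin k × Fin e)).Colorable (9 * m ^ 2) := by
  refine (conflictGraph_colorable fun t : T => entryIndex_left_injective hlk t.1).mono ?_
  rw [Fintype.card_coe]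
  calc T.card * (T.card - 1) + 1 ≤ 3 * m * (3 * m - 1) + 1 := by gcongr
    _ ≤ 3 * m * (3 * m - 1) + 3 * m := by lia
    _ = 9 * m ^ 2 := by
        rw [← Nat.mul_succ, Nat.succ_eq_add_one, Nat.sub_add_cancel (by lia)]
        ring

lemma le_measureReal_satisfiesRIP_circulantBlock {Ω : Type*} [MeasurableSpace Ω] {μ : Measure Ω}
    [IsProbabilityMeasure μ] {B : Ω → ZMod k → Matrix (Fin d) (Fin e) ℝ} {K : ℝ≥0} {δ : ℝ}
    {n N m χ : ℕ} (hn : n = l * d) (hN : N = k * e)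
    (hindep : iIndepFun (fun (p : ZMod k × Fin d × Fin e) ω => B ω p.1 p.2.1 p.2.2) μ)
    (hB : ∀ i a b, IsUnitSubgaussian (fun ω => √(n : ℝ) * B ω i a b) K μ)
    (hn_pos : 0 < n) (hm : 1 ≤ m) (hmN : 3 * m ≤ N)
    (hcol : ∀ T : Finset (Fin k × Fin e), T.card ≤ 3 * m →
      (conflictGraph fun (i : Fin l × Fin d) (t : T) => entryIndex i t.1).Colorable χ)
    (hδ : 0 ≤ δ) (hχ : 26 * (m * Real.log (N / m)) ≤
      min δ 1 ^ 2 / (12288 * K ^ 2) * (n / χ)) :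
    1 - Real.exp (-(min δ 1 ^ 2 / (12288 * K ^ 2) * (n / χ) / 2)) ≤
      μ.real {ω | SatisfiesRIP (circulantBlock l k (B ω)) (3 * m) δ} := by
  have card_rows : Fintype.card (Fin l × Fin d) = n := by simp [hn]
  have card_columns : Fintype.card (Fin k × Fin e) = N := by simp [hN]
  simp only [circulantBlock_eq_patternMatrix]
  refine (le_measureReal_satisfiesRIP_patternMatrix card_rows card_columns
    (fun q => hB q.1 q.2.1 q.2.2) hindep entryIndex_injective hn_pos hm hmN hcol
    (le_min hδ zero_le_one) (min_le_right δ 1) hχ).trans (measureReal_mono fun ω hω => ?_)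
  exact SatisfiesRIP.mono hω (min_le_left δ 1)

end CirculantBlock

theorem theorem2_general {δ : ℝ} (hδ : 0 < δ) {K : ℝ≥0} (hK : 0 < K) :
    ∃ c₁ > (0 : ℝ), ∃ c₂ > (0 : ℝ),
      ∀ (m l k d e n N : ℕ), 1 ≤ m → 1 ≤ l → n = l * d → N = k * e → 3 * m ≤ N →
      ∀ (Ω : Type*) [MeasurableSpace Ω] (μ : Measure Ω) [IsProbabilityMeasure μ]
        (B : Ω → ZMod k → Matrix (Fin d) (Fin e) ℝ),
        iIndepFun (fun (p : ZMod k × Fin d × Fin e) (ω : Ω) => B ω p.1 p.2.1 p.2.2) μ →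
        (∀ i a b, IsUnitSubgaussian (fun ω => √(n : ℝ) * B ω i a b) K μ) →
        (c₁ * l * m * Real.log ((N : ℝ) / m) ≤ n →
          1 - Real.exp (-c₂ * n / l) ≤
            μ.real {ω | SatisfiesRIP (circulantBlock l k (B ω)) (3 * m) δ}) ∧
        (l ≤ k → c₁ * (m : ℝ) ^ 3 * Real.log ((N : ℝ) / m) ≤ n →
          1 - Real.exp (-c₂ * n / (m : ℝ) ^ 2) ≤
            μ.real {ω | SatisfiesRIP (circulantBlock l k (B ω)) (3 * m) δ}) := by
  have : 0 < min δ 1 := lt_min hδ one_pos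
  set r : ℝ := min δ 1 ^ 2 / (12288 * K ^ 2) with r_def
  have r_pos : 0 < r := by positivity
  refine ⟨234 / r, by positivity, r / 18, by positivity, ?_⟩
  intro m l k d e n N hm hl hn hN hmN Ω _ μ _ B hindep hB
  have m_pos : (0 : ℝ) < m := by exact_mod_cast hm
  have : (0 : ℝ) < l := by exact_mod_cast hl
  have log_pos : 0 < Real.log (N / m) :=
    Real.log_pos ((one_lt_div m_pos).2 (by exact_mod_cast (by lia : m < N)))
  refine ⟨fun hcond => ?_, fun hlk hcond => ?_⟩
  · have n_pos : (0 : ℝ) < n := lt_of_lt_of_le (by positivity) hcond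
    refine le_trans ?_ (le_measureReal_satisfiesRIP_circulantBlock hn hN hindep hB
      (by exact_mod_cast n_pos) hm hmN
      (fun T _ => conflictGraph_entryIndex_colorable_block T) hδ.le ?_)
    · rw [← r_def]
      gcongr
      have : 0 ≤ r * (n / l) := by positivity
      linarith [show -(r / 18) * n / l = -(r * (n / l) / 18) by ring]
    · calc 26 * (m * Real.log (N / m)) ≤ r * (234 / r * l * m * Real.log (N / m) / l) := by
            field_simp
            norm_num
        _ ≤ r * (n / l) := by gcongr
  · have n_pos : (0 : ℝ) < n := lt_of_lt_of_le (by positivity) hcond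
    refine le_of_eq_of_le ?_ (le_measureReal_satisfiesRIP_circulantBlock hn hN hindep hB
      (by exact_mod_cast n_pos) hm hmN
      (fun T hT => conflictGraph_entryIndex_colorable hlk hT hm) hδ.le ?_)
    · rw [← r_def]
      push_cast
      congr 2
      field_simp
      norm_num
    · calc 26 * (m * Real.log (N / m))
          = r * (234 / r * m ^ 3 * Real.log (N / m) / (9 * m ^ 2 : ℕ)) := by
            push_cast
            field_simp
            norm_num
        _ ≤ r * (n / (9 * m ^ 2 : ℕ)) := by gcongr

theorem theorem2 (δ : ℝ) (hδ : δ ∈ Set.Ioo (0 : ℝ) 1) :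
    ∃ c₁ > (0 : ℝ), ∃ c₂ > (0 : ℝ),
      ∀ (m l k d e n N : ℕ), 1 ≤ m → 1 ≤ l → l ≤ k → n = l * d → N = k * e → 3 * m ≤ N →
      ∀ (ν : Measure ℝ), IsEntryLaw n ν →
      ∀ (Ω : Type*) [MeasurableSpace Ω] (μ : Measure Ω) [IsProbabilityMeasure μ]
        (B : Ω → ZMod k → Matrix (Fin d) (Fin e) ℝ),
        iIndepFun (fun (p : ZMod k × Fin d × Fin e) (ω : Ω) => B ω p.1 p.2.1 p.2.2) μ →
        (∀ (i : ZMod k) (a : Fin d) (b : Fin e), HasLaw (fun ω => B ω i a b) ν μ) →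
        (l ≤ 3 * m * (3 * m - 1) →
          c₁ * l * m * Real.log ((N : ℝ) / m) ≤ n →
          1 - Real.exp (-c₂ * n / l) ≤
            μ.real {ω | SatisfiesRIP (circulantBlock l k (B ω)) (3 * m) δ}) ∧
        (3 * m * (3 * m - 1) < l →
          c₁ * (m : ℝ) ^ 3 * Real.log ((N : ℝ) / m) ≤ n →
          1 - Real.exp (-c₂ * n / (m : ℝ) ^ 2) ≤
            μ.real {ω | SatisfiesRIP (circulantBlock l k (B ω)) (3 * m) δ}) := by
  obtain ⟨c₁, c₁_pos, c₂, c₂_pos, rip⟩ := theorem2_general hδ.1 (K := 3) (by norm_num)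
  refine ⟨c₁, c₁_pos, c₂, c₂_pos, ?_⟩
  intro m l k d e n N hm hl hlk hn hN hmN ν hν Ω _ μ _ B hindep hB
  have := rip m l k d e n N hm hl hn hN hmN Ω μ B hindep fun i a b =>
    hν.isUnitSubgaussian (hn ▸ Nat.mul_pos hl a.pos) (hB i a b)
  exact ⟨fun _ => this.1, fun _ => this.2 hlk⟩
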